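/- **Theorem (Flexible Erasure Patterns).** *Cooperation.* Let $G=(V,E)$ be a finite simple graph. For each $i\in V$ let $\mathcal M_i$ be a set of neighbours of $i$ in $G$ (its first-level neighbours), with $j\in\mathcal M_i\iff i\in\mathcal M_j$, and let $L_i\in\mathbb N$ be its number of cooperation levels. Let $C_1,\dots,C_T$ be pairwise disjoint cycles of matrix positions: each $C_t\subseteq V\times V$ is a finite set with row set $X_t$ and column set $Y_t$, $|X_t|=|Y_t|\in\{2,3\}$, such that $Y_{t;i}=\{j:(i,j)\in C_t\}$ has two elements for each $i\in X_t$ and $X_{t;j}=\{i:(i,j)\in C_t\}$ has two elements for each $j\in Y_t$; moreover $i\neq j$ and $j\notin\mathcal M_i$ for all $(i,j)\in C_t$. Each cycle has a group number $g_t$ and, for each $j\in Y_t$, a level $\ell_{t;j}\in\{2,\dots,L_j\}$. Put $R_{j;\ell}=\{t: j\in Y_t,\ \ell_{t;j}=\ell\}$, $V_{j;\ell}=\bigcup_{t\in R_{j;\ell}}X_{t;j}$, $A_j=\{g_t: j\in Y_t\}$ and $U_{j;g}=\bigcup_{t:\,g_t=g,\,j\in Y_t}X_{t;j}$. Assume compatibility: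 (a) for each $g$, all $Y_t$ with $g_t=g$ are contained in one maximal clique of the first-level graph $(V,\{\{i,j\}:j\in\mathcal M_i\})$; (b) for each $i$ and each $2\le\ell\le L_i$ there is a unique $g\in A_i$ with $V_{i;\ell}=U_{i;g}$. *Code.* Let $\mathbb F$ be a finite field of characteristic $2$, and let $k_i,r_i,\delta_i,\gamma_{i;t}\in\mathbb N$, $n_i=k_i+r_i$, $\eta_{j;\ell}=\max\{\gamma_{i;t}: t\in R_{j;\ell},\ i\in X_{t;j}\}$ ($0$ if the set is empty). For each $i$ let $$T_i=\Big(\tfrac1{a_{i,x}-b_{i,y}}\Big)_{x,y}=\begin{bmatrix}A_{i,i}&B_i\ \ E_i\\ \begin{smallmatrix}U_i\\ V_i\end{smallmatrix}& Z_i\end{bmatrix}$$ be a Cauchy matrix over $\mathbb F$ (all $a_{i,x},b_{i,y}$ distinct), where $A_{i,i}$ is $k_i\times r_i$, $B_i$ consists of blocks $B_{i,j}$ of size $k_i\times\delta_j$ ($j\in\mathcal M_i$), $E_i$ of blocks $E_{i;t}$ of size $k_i\times\gamma_{i;t}$ ($t$ with $i\in X_t$), $U_i$ is $\delta_i\times r_i$,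 and $V_i$ consists of blocks $V_{i;\ell}$ of size $\eta_{i;\ell}\times r_i$ ($2\le\ell\le L_i$). For $i\ne j$ put $A_{i,j}=B_{i,j}U_j$ if $j\in\mathcal M_i$; $A_{i,j}=[\,E_{i;t}\ \ 0\,]\,V_{j;\ell_{t;j}}$, with $\eta_{j;\ell_{t;j}}-\gamma_{i;t}$ zero columns, if $(i,j)\in C_t$; and $A_{i,j}=0$ otherwise. The code $\mathcal C$ consists of all $(c_j)_{j\in V}$ with $c_j=\big(m_j,\sum_{i\in V} m_iA_{i,j}\big)\in\mathbb F^{n_j}$, $m_i\in\mathbb F^{k_i}$. *Erasures.* Let $u\in\mathbb N^V$ with $u_i\le n_i$ for all $i$. Call $i$ *locally recoverable* if $u_i\le r_i-\delta_i-\sum_{\ell=2}^{L_i}\eta_{i;\ell}$ (as integers), and *non-local* otherwise. A *decoding graph* at a node $v$ is a finite acyclic directed graph $\mathcal T$ whose vertices are nodes in $V$ and whose edges join cooperating nodes (pairs $i,j$ with $j\in\mathcal M_i$, or with $(i,j)$ or $(j,i)$ on some cycle $C_t$), in which $v$ is the only node without parents, all leaves (nodes without children) are non-local, and every node $i$ that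 is not a leaf, with set of parents $P_i$ and set of children $\mathrm{Ch}_i$, satisfies: 1. if $i$ is locally recoverable, then there is $\Lambda\subseteq\{2,\dots,L_i\}$ such that $|P_i\cap\mathcal M_i|\le1$, $|P_i\cap V_{i;\ell}|=1$ for all $\ell\in\Lambda$, and $P_i\cup\mathrm{Ch}_i$ is the set of all non-local nodes in $\bigcup_{\ell\in\Lambda}V_{i;\ell}$, together with those in $\mathcal M_i$ when $|P_i\cap\mathcal M_i|=1$; 2. if $i$ is non-local, then all nodes in $P_i\cup\mathrm{Ch}_i$ are locally recoverable. Suppose that for every non-local node $i$: * all nodes in $\mathcal M_i$ are locally recoverable; and * there is a decoding graph $\mathcal T$ at $i$ such that $u_j\le r_j$ for every leaf $j$ of $\mathcal T$, and, for every non-local node $j$ of $\mathcal T$, $$u_j\le r_j+\sum_{m\in\mathcal M_j\cap \mathrm{Ch}_j}\delta_m+\sum_{t:\ Y_{t;j}\cap \mathrm{Ch}_j\neq\varnothing}\gamma_{j;t},$$ where $t$ runs over the cycles with $j\in X_t$. Then $u$ is a recoverable erasure pattern of $\mathcal C$: whenever exactly $u_i$ symbols of $c_i$ are erased for each $i\in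 V$, in any positions, the codeword is uniquely determined by the symbols that are not erased. -/

import Mathlib

open Finset

/-- The data of a multi-level cooperation scheme on a node set `V`, with cycles indexed by `ι`.
A cycle of the cooperation matrix is recorded as the set of matrix positions `(row, column)` that
are its vertices. -/
structure CooperationData (V ι : Type*) where
  /-- `first i` is the set of nodes that cooperate with node `i` at the first level. -/
  first : V → Finset V
  /-- The number of cooperation levels of a node. -/
  depth : V → ℕ
  /-- The vertices of the `t`-th cycle. -/
  cycle : ι → Finset (V × V)
  /-- The group number of the `t`-th cycle. -/
  group : ι → ℕ
  /-- `level t j` is the cooperation level of column `j` in the `t`-th cycle. -/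
  level : ι → V → ℕ

namespace CooperationData

variable {V ι : Type*} [DecidableEq V] (D : CooperationData V ι)

/-- The rows `X_t` of the `t`-th cycle. -/
def rows (t : ι) : Finset V := (D.cycle t).image Prod.fst

/-- The columns `Y_t` of the `t`-th cycle. -/
def cols (t : ι) : Finset V := (D.cycle t).image Prod.snd

/-- The rows `X_{t;j}` in which the `t`-th cycle meets column `j`. -/
def rowsAt (t : ι) (j : V) : Finset V := (D.rows t).filter fun i => (i, j) ∈ D.cycle t

/-- The columns `Y_{t;i}` in which the `t`-th cycle meets row `i`. -/
def colsAt (t : ι) (i : V) : Finset V := (D.cols t).filter fun j => (i, j) ∈ D.cycle t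

variable [Fintype ι]

/-- `R_{j;ℓ}`: the cycles that meet column `j` at its `ℓ`-th cooperation level. -/
def cyclesAt (j : V) (ℓ : ℕ) : Finset ι :=
  univ.filter fun t => j ∈ D.cols t ∧ D.level t j = ℓ

/-- `V_{j;ℓ}`: the rows in which the cycles of `R_{j;ℓ}` meet column `j`. -/
def helpers (j : V) (ℓ : ℕ) : Finset V := (D.cyclesAt j ℓ).biUnion fun t => D.rowsAt t j

/-- `A_j`: the numbers of the groups containing a cycle that meets column `j`. -/
def groupsAt (j : V) : Finset ℕ := (univ.filter fun t => j ∈ D.cols t).image D.group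

/-- `U_{j;g}`: the rows in which the cycles of group `g` meet column `j`. -/
def groupRows (j : V) (g : ℕ) : Finset V :=
  (univ.filter fun t => D.group t = g ∧ j ∈ D.cols t).biUnion fun t => D.rowsAt t j

/-- The graph of first-level cooperation. -/
def firstGraph (D : CooperationData V ι) : SimpleGraph V :=
  SimpleGraph.fromRel fun i j => j ∈ D.first i

/-- Nodes `i` and `j` cooperate with each other at some level. -/
def Cooperate (i j : V) : Prop :=
  j ∈ D.first i ∨ ∃ t, (i, j) ∈ D.cycle t ∨ (j, i) ∈ D.cycle t

end CooperationData

/-- A compatible graph on the graph `G` of a decentralized storage network. -/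
structure CompatibleGraph {V : Type*} [DecidableEq V] (G : SimpleGraph V)
    (ι : Type*) [Fintype ι] extends CooperationData V ι where
  /-- First-level cooperation is symmetric. -/
  first_symm : ∀ i j, j ∈ first i → i ∈ first j
  /-- First-level cooperation takes place between neighbours. -/
  first_adj : ∀ i j, j ∈ first i → G.Adj i j
  /-- A cycle has two rows (a pair of edges) or three rows (a pair of triangles). -/
  rows_card : ∀ t, (toCooperationData.rows t).card = 2 ∨ (toCooperationData.rows t).card = 3
  /-- As many columns as rows. -/
  cols_card : ∀ t, (toCooperationData.cols t).card = (toCooperationData.rows t).card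
  rowsAt_card : ∀ t, ∀ j ∈ toCooperationData.cols t, (toCooperationData.rowsAt t j).card = 2
  colsAt_card : ∀ t, ∀ i ∈ toCooperationData.rows t, (toCooperationData.colsAt t i).card = 2
  /-- Cycles pass only through positions off the diagonal that are not used at the first level. -/
  cycle_off : ∀ t i j, (i, j) ∈ cycle t → i ≠ j ∧ j ∉ first i
  /-- The levels used in column `j` lie between `2` and `depth j`. -/
  level_mem : ∀ t, ∀ j ∈ toCooperationData.cols t, level t j ∈ Icc 2 (depth j)
  cycle_disjoint : ∀ t t', t ≠ t' → Disjoint (cycle t) (cycle t')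
  /-- The columns spanned by a cycle group lie in one maximal clique of the first-level graph. -/
  group_clique : ∀ g : ℕ, ∃ S : Set V, Maximal toCooperationData.firstGraph.IsClique S ∧
    ∀ t, group t = g → (toCooperationData.cols t : Set V) ⊆ S
  /-- At each node, each level above the first corresponds to a unique cycle group. -/
  level_group : ∀ i, ∀ ℓ ∈ Icc 2 (depth i), ∃! g, g ∈ toCooperationData.groupsAt i ∧
    toCooperationData.helpers i ℓ = toCooperationData.groupRows i g

/-- The numerical parameters of a hierarchical code. -/
structure CodeParams (V ι : Type*) where
  /-- The length of the message of a node. -/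
  k : V → ℕ
  /-- The number of parity symbols of a node. -/
  r : V → ℕ
  /-- The first-level cooperation parameter. -/
  δ : V → ℕ
  /-- `γ i t` is the cooperation parameter of row `i` in the `t`-th cycle. -/
  γ : V → ι → ℕ

namespace CompatibleGraph

variable {V ι F : Type*} [DecidableEq V] [Fintype ι] {G : SimpleGraph V}
variable (H : CompatibleGraph G ι) (P : CodeParams V ι)

/-- `η_{j;ℓ}`: the maximum of `γ_{i;t}` over the cycles `t` in `R_{j;ℓ}` and rows `i` in
`X_{t;j}`. -/
def eta (j : V) (ℓ : ℕ) : ℕ :=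
  (H.cyclesAt j ℓ).sup fun t => (H.rowsAt t j).sup fun i => P.γ i t

/-- The row indices of the Cauchy matrix of node `i`: a block of `k_i` rows, a block of `δ_i` rows,
and for each level `2 ≤ ℓ ≤ L_i` a block of `η_{i;ℓ}` rows. -/
abbrev RowIdx (i : V) : Type :=
  Fin (P.k i) ⊕ Fin (P.δ i) ⊕ (Σ ℓ : {ℓ : ℕ // ℓ ∈ Icc 2 (H.depth i)}, Fin (H.eta P i ℓ.1))

/-- The column indices of the Cauchy matrix of node `i`: a block of `r_i` columns, for each
first-level partner `j` a block of `δ_j` columns, and for each cycle `t` that meets row `i` a block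
of `γ_{i;t}` columns. -/
abbrev ColIdx (i : V) :=
  Fin (P.r i) ⊕ (Σ j : {j : V // j ∈ H.first i}, Fin (P.δ j.1)) ⊕
    (Σ t : {t : ι // i ∈ H.rows t}, Fin (P.γ i t.1))

theorem mem_rows {t : ι} {i j : V} (h : (i, j) ∈ H.cycle t) : i ∈ H.rows t :=
  mem_image_of_mem Prod.fst h

theorem level_mem_of_mem {t : ι} {i j : V} (h : (i, j) ∈ H.cycle t) :
    H.level t j ∈ Icc 2 (H.depth j) :=
  H.level_mem t j (mem_image_of_mem Prod.snd h)

/-- For each node, the row and column indicators of its Cauchy matrix: pairwise distinct elements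
of the field. -/
structure CauchyPoints (F : Type*) where
  a : ∀ i, H.RowIdx P i → F
  b : ∀ i, H.ColIdx P i → F
  a_injective : ∀ i, Function.Injective (a i)
  b_injective : ∀ i, Function.Injective (b i)
  a_ne_b : ∀ i x y, a i x ≠ b i y

variable {H P} [Field F] (Q : H.CauchyPoints P F)

namespace CauchyPoints

/-- The Cauchy matrix `T_i`. -/
def cauchy (i : V) : Matrix (H.RowIdx P i) (H.ColIdx P i) F :=
  Matrix.of fun x y => 1 / (Q.a i x - Q.b i y)

/-- The block `A_{i,i}` of `T_i`. -/
def diagBlock (i : V) : Matrix (Fin (P.k i)) (Fin (P.r i)) F :=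
  Matrix.of fun x y => Q.cauchy i (Sum.inl x) (Sum.inl y)

/-- The block `B_{i,j}` of `T_i`, for a first-level partner `j` of `i`. -/
def firstBlock (i j : V) (h : j ∈ H.first i) : Matrix (Fin (P.k i)) (Fin (P.δ j)) F :=
  Matrix.of fun x y => Q.cauchy i (Sum.inl x) (Sum.inr (Sum.inl ⟨⟨j, h⟩, y⟩))

/-- The block of `T_i` that belongs to a cycle `t` meeting row `i`. -/
def cycleBlock (i : V) (t : ι) (h : i ∈ H.rows t) : Matrix (Fin (P.k i)) (Fin (P.γ i t)) F :=
  Matrix.of fun x y => Q.cauchy i (Sum.inl x) (Sum.inr (Sum.inr ⟨⟨t, h⟩, y⟩))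

/-- The block `U_j` of `T_j`. -/
def uBlock (j : V) : Matrix (Fin (P.δ j)) (Fin (P.r j)) F :=
  Matrix.of fun x y => Q.cauchy j (Sum.inr (Sum.inl x)) (Sum.inl y)

/-- The block `V_{j;ℓ}` of `T_j`. -/
def vBlock (j : V) (ℓ : ℕ) (h : ℓ ∈ Icc 2 (H.depth j)) :
    Matrix (Fin (H.eta P j ℓ)) (Fin (P.r j)) F :=
  Matrix.of fun x y => Q.cauchy j (Sum.inr (Sum.inr ⟨⟨ℓ, h⟩, x⟩)) (Sum.inl y)

/-- The block of the cycle `t` in row `i`, padded by zero columns on the right to the width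
`η_{j;ℓ}`, where `(i, j)` is a vertex of the cycle and `ℓ` its level in column `j`. -/
def paddedBlock (i j : V) (t : ι) (h : (i, j) ∈ H.cycle t) :
    Matrix (Fin (P.k i)) (Fin (H.eta P j (H.level t j))) F :=
  Matrix.of fun x y =>
    if hy : (y : ℕ) < P.γ i t then Q.cycleBlock i t (H.mem_rows h) x ⟨y, hy⟩ else 0

/-- The matrix `A_{i,j}` by which the message of node `i` enters the parities of node `j`. In the
last case at most one summand is non-zero, as the cycles are disjoint. -/
def parityBlock (i j : V) : Matrix (Fin (P.k i)) (Fin (P.r j)) F :=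
  if hij : i = j then (Q.diagBlock i).submatrix id (Fin.cast (by rw [hij]))
  else if h : j ∈ H.first i then Q.firstBlock i j h * Q.uBlock j
  else ∑ t : ι, if ht : (i, j) ∈ H.cycle t then
    Q.paddedBlock i j t ht * Q.vBlock j (H.level t j) (H.level_mem_of_mem ht) else 0

/-- The systematic generator matrix. The part of a codeword stored at node `j` consists of `k_j`
message symbols and `r_j` parity symbols. -/
def generator : Matrix (Σ i, Fin (P.k i)) (Σ j, Fin (P.k j) ⊕ Fin (P.r j)) F :=
  Matrix.of fun x y => match y with
    | ⟨j, Sum.inl s⟩ => if x = ⟨j, s⟩ then 1 else 0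
    | ⟨j, Sum.inr s⟩ => Q.parityBlock x.1 j x.2 s

/-- The hierarchical code: the row space of the generator matrix. -/
def code [Fintype V] : Submodule F ((Σ j, Fin (P.k j) ⊕ Fin (P.r j)) → F) :=
  LinearMap.range (Matrix.vecMulLinear Q.generator)

end CauchyPoints

variable (H P)

/-- With `u` erasures per node, the codeword at node `i` is locally recoverable if
`u_i ≤ r_i - δ_i - ∑_{ℓ=2}^{L_i} η_{i;ℓ}` (as integers). -/
def LocallyRecoverable (u : V → ℕ) (i : V) : Prop :=
  u i + P.δ i + ∑ ℓ ∈ Icc 2 (H.depth i), H.eta P i ℓ ≤ P.r i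

end CompatibleGraph

/-- An erasure pattern `u` is recoverable if, whenever exactly `u_i` symbols are erased at each node
`i`, the codeword is determined by the symbols that are not erased. -/
def IsRecoverablePattern {V F : Type*} [Field F] {k r : V → ℕ}
    (C : Submodule F ((Σ j : V, Fin (k j) ⊕ Fin (r j)) → F)) (u : V → ℕ) : Prop :=
  ∀ erased : ∀ i, Finset (Fin (k i) ⊕ Fin (r i)), (∀ i, (erased i).card = u i) →
    ∀ c ∈ C, ∀ c' ∈ C, (∀ i, ∀ s ∉ erased i, c ⟨i, s⟩ = c' ⟨i, s⟩) → c = c'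

/-- A finite directed graph on some of the nodes in `V`. -/
structure DirGraph (V : Type*) where
  verts : Finset V
  edges : Finset (V × V)
  edges_mem : ∀ i j, (i, j) ∈ edges → i ∈ verts ∧ j ∈ verts

namespace DirGraph

variable {V : Type*} [DecidableEq V] (T : DirGraph V)

/-- The nodes `j` with an edge from `i` to `j`. -/
def children (i : V) : Finset V := T.verts.filter fun j => (i, j) ∈ T.edges

/-- The nodes `j` with an edge from `j` to `i`. -/
def parents (i : V) : Finset V := T.verts.filter fun j => (j, i) ∈ T.edges

/-- A leaf is a node of the graph without children. -/
def IsLeaf (i : V) : Prop := i ∈ T.verts ∧ T.children i = ∅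

end DirGraph

/-- `T` is a decoding graph at `root` for multi-level cooperation, where `Loc` is the property of
being locally recoverable. -/
structure IsDecodingGraph {V ι : Type*} [DecidableEq V] [Fintype ι] {G : SimpleGraph V}
    (H : CompatibleGraph G ι) (Loc : V → Prop) (root : V) (T : DirGraph V) : Prop where
  edges_cooperate : ∀ i j, (i, j) ∈ T.edges → H.Cooperate i j
  acyclic : ∀ i, ¬ Relation.TransGen (fun v w => (v, w) ∈ T.edges) i i
  root_mem : root ∈ T.verts
  /-- The root is the only node without parents. -/
  parents_eq_empty_iff : ∀ i ∈ T.verts, T.parents i = ∅ ↔ i = root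
  leaf_not_loc : ∀ i, T.IsLeaf i → ¬ Loc i
  loc_inner : ∀ i ∈ T.verts, ¬ T.IsLeaf i → Loc i → ∃ Λ ⊆ Icc 2 (H.depth i),
    (T.parents i ∩ H.first i).card ≤ 1 ∧
    (∀ ℓ ∈ Λ, (T.parents i ∩ H.helpers i ℓ).card = 1) ∧
    ∀ w, w ∈ T.parents i ∪ T.children i ↔ ¬ Loc w ∧
      ((∃ ℓ ∈ Λ, w ∈ H.helpers i ℓ) ∨ ((T.parents i ∩ H.first i).card = 1 ∧ w ∈ H.first i))
  not_loc_inner : ∀ i ∈ T.verts, ¬ T.IsLeaf i → ¬ Loc i →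
    ∀ w ∈ T.parents i ∪ T.children i, Loc w

/-!
The code is linear, so it suffices to show that a codeword `m G` that vanishes outside the erased
positions is zero. Let `s_j = ∑ m_i B_{i,j}` (`crossFirst`) and
`w_{j;ℓ} = ∑ m_i [E_{i;t} 0]` (`crossCycle`) be the cross parities that node `j` receives at the
first level and at level `ℓ`. The parity symbols of node `j` are the product of the concatenated
vector `(m_j, s_j, w_j)` (`localVec`) with the first `r_j` columns of the Cauchy matrix `T_j`
(`vecMul_generator_inr`).

Every square submatrix of a Cauchy matrix is invertible, so a vector with at most `N` non-zero
entries that is orthogonal to `N` columns vanishes (`eq_zero_of_sum_cauchy_eq_zero`). At a locally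
recoverable node this kills `m_j`, `s_j` and `w_j` all at once (`localVec_eq_zero`).

At a non-local node `i` the cross parities vanish as well. All partners of the first level are
locally recoverable, so `s_i = 0`. For `w_{i;ℓ}`, the compatibility condition identifies the cycles
meeting column `i` at level `ℓ` with those of one group `g` meeting column `i`
(`exists_group_of_level`), so that `w_{i;ℓ}` is the sum `W_{g;i}` (`crossGroup`) over the cycles of
the group. Every row of a cycle contains exactly two of its positions, so in characteristic `2` the
sum of `W_{g;j}` over all columns `j` is zero (`sum_crossGroup`). The columns of the group other
than `i` are in a clique with `i`, hence are partners of `i`, hence are locally recoverable, and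
their terms vanish; so `W_{g;i} = 0`.

Finally the non-local nodes of a decoding graph are recovered from the leaves to the root. Let `i`
be one of them and suppose that `m` vanishes on all non-local nodes below `i`. If `j` is a child of
`i`, then `j` is locally recoverable, and the other non-local nodes contributing to the cross parity
of `j` that involves `i` are children of `j`. As this cross parity is zero, so is the contribution
of `i` to it. Hence `m_i` is orthogonal to the columns of `T_i` in the blocks `B_{i,j}` and
`E_{i;t}` that belong to children of `i`, and the bound on `u_i` says that these, together with the
parity symbols that are not erased, are at least as many as the erased symbols of `m_i`.
-/

/-! ### Cauchy matrices -/

/-- A vector in the left kernel of a set of columns of a Cauchy matrix vanishes if its support is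
no larger than the set of columns. -/
theorem eq_zero_of_sum_cauchy_eq_zero {α β F : Type*} [Field F] [Fintype α]
    {a : α → F} {b : β → F} (ha : Function.Injective a) (hb : Function.Injective b)
    (hab : ∀ x y, a x ≠ b y) (v : α → F) (S : Finset α) (C : Finset β) (hS : ∀ x ∉ S, v x = 0)
    (hcard : S.card ≤ C.card) (h : ∀ y ∈ C, ∑ x, v x * (1 / (a x - b y)) = 0) : v = 0 := by
  classical
  -- Clearing denominators gives a polynomial of degree less than `#S` with roots `b y`, `y ∈ C`.
  let p : Polynomial F :=
    ∑ x ∈ S, Polynomial.C (v x) * ∏ z ∈ S.erase x, (Polynomial.C (a z) - Polynomial.X)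
  have hdeg : p.degree < C.card := by
    rcases S.eq_empty_or_nonempty with hS0 | hS0
    · simp [p, hS0, Polynomial.degree_zero]
    have hpos : 0 < S.card := hS0.card_pos
    refine lt_of_lt_of_le ?_ (Nat.cast_le.mpr hcard)
    refine (Polynomial.degree_sum_le _ _).trans_lt ?_
    rw [Finset.sup_lt_iff (WithBot.bot_lt_coe _)]
    intro x hx
    refine lt_of_le_of_lt (Polynomial.smul_eq_C_mul (v x) ▸ Polynomial.degree_smul_le _ _) ?_
    rw [Polynomial.degree_prod]
    have h1 : ∀ z ∈ S.erase x, (Polynomial.C (a z) - Polynomial.X).degree = 1 := by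
      intro z _
      rw [← neg_sub, Polynomial.degree_neg, Polynomial.degree_X_sub_C]
    rw [Finset.sum_congr rfl h1, Finset.sum_const, Finset.card_erase_of_mem hx, nsmul_one]
    exact_mod_cast Nat.sub_lt hpos one_pos
  have hp : p = 0 := by
    have hdeg' : p.degree < (C.image b).card := by rwa [Finset.card_image_of_injective _ hb]
    refine Polynomial.eq_zero_of_degree_lt_of_eval_finset_eq_zero _ hdeg' ?_
    intro z hz
    obtain ⟨y, hy, rfl⟩ := Finset.mem_image.mp hz
    have hsum : ∑ x ∈ S, v x * (1 / (a x - b y)) = 0 := by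
      rw [← h y hy]
      exact Finset.sum_subset (Finset.subset_univ _) fun x _ hx => by rw [hS x hx, zero_mul]
    have : p.eval (b y) = (∏ z ∈ S, (a z - b y)) * ∑ x ∈ S, v x * (1 / (a x - b y)) := by
      simp only [p, Polynomial.eval_finsetSum, Polynomial.eval_mul, Polynomial.eval_C,
        Polynomial.eval_prod, Polynomial.eval_sub, Polynomial.eval_X, Finset.mul_sum]
      refine Finset.sum_congr rfl fun x hx => ?_
      rw [← Finset.mul_prod_erase S _ hx]
      have := sub_ne_zero.mpr (hab x y)
      field_simp
    rw [this, hsum, mul_zero]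
  ext x
  by_cases hx : x ∈ S
  · have hev : p.eval (a x) = v x * ∏ z ∈ S.erase x, (a z - a x) := by
      simp only [p, Polynomial.eval_finsetSum, Polynomial.eval_mul, Polynomial.eval_C,
        Polynomial.eval_prod, Polynomial.eval_sub, Polynomial.eval_X]
      refine Finset.sum_eq_single_of_mem x hx fun x' _ hne => ?_
      rw [Finset.prod_eq_zero (Finset.mem_erase.mpr ⟨hne.symm, hx⟩) (sub_self _), mul_zero]
    rw [hp, Polynomial.eval_zero] at hev
    refine (mul_eq_zero.mp hev.symm).resolve_right ?_
    exact Finset.prod_ne_zero_iff.mpr fun z hz =>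
      sub_ne_zero.mpr (ha.ne (Finset.ne_of_mem_erase hz))
  · exact hS x hx

namespace CompatibleGraph

variable {V ι F : Type*} [DecidableEq V] [Fintype ι] {G : SimpleGraph V}

/-! ### Levels and cycle groups -/

section Cycles

variable (H : CompatibleGraph G ι)

theorem mem_rowsAt {t : ι} {i j : V} : i ∈ H.rowsAt t j ↔ (i, j) ∈ H.cycle t := by
  simp only [CooperationData.rowsAt, mem_filter, and_iff_right_iff_imp]
  exact H.mem_rows

theorem mem_cols {t : ι} {i j : V} (h : (i, j) ∈ H.cycle t) : j ∈ H.cols t :=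
  mem_image_of_mem Prod.snd h

theorem mem_colsAt {t : ι} {i j : V} : j ∈ H.colsAt t i ↔ (i, j) ∈ H.cycle t := by
  simp only [CooperationData.colsAt, mem_filter, and_iff_right_iff_imp]
  exact H.mem_cols

theorem mem_cyclesAt {t : ι} {j : V} {ℓ : ℕ} :
    t ∈ H.cyclesAt j ℓ ↔ j ∈ H.cols t ∧ H.level t j = ℓ := by
  simp [CooperationData.cyclesAt]

theorem mem_helpers {i j : V} {ℓ : ℕ} :
    i ∈ H.helpers j ℓ ↔ ∃ t, (i, j) ∈ H.cycle t ∧ H.level t j = ℓ := by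
  simp only [CooperationData.helpers, mem_biUnion, mem_cyclesAt, mem_rowsAt]
  exact ⟨fun ⟨t, ⟨_, h⟩, h'⟩ => ⟨t, h', h⟩, fun ⟨t, h', h⟩ => ⟨t, ⟨H.mem_cols h', h⟩, h'⟩⟩

theorem mem_groupRows {i j : V} {g : ℕ} :
    i ∈ H.groupRows j g ↔ ∃ t, (i, j) ∈ H.cycle t ∧ H.group t = g := by
  simp only [CooperationData.groupRows, mem_biUnion, mem_filter, mem_univ, true_and, mem_rowsAt]
  exact ⟨fun ⟨t, ⟨h, _⟩, h'⟩ => ⟨t, h', h⟩, fun ⟨t, h', h⟩ => ⟨t, ⟨h, H.mem_cols h'⟩, h'⟩⟩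

theorem cycle_unique {t t' : ι} {p : V × V} (h : p ∈ H.cycle t) (h' : p ∈ H.cycle t') :
    t = t' := by
  by_contra hne
  exact disjoint_left.mp (H.cycle_disjoint t t' hne) h h'

/-- The cycles that meet column `i` at level `ℓ` are those of one group that meet column `i`:
as the cycles are disjoint, they can be read off from their rows in column `i`. -/
theorem exists_group_of_level (i : V) {ℓ : ℕ} (hℓ : ℓ ∈ Icc 2 (H.depth i)) :
    ∃ g, ∀ t, i ∈ H.cols t → (H.level t i = ℓ ↔ H.group t = g) := by
  obtain ⟨g, ⟨-, hg⟩, -⟩ := H.level_group i ℓ hℓ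
  refine ⟨g, fun t ht => ?_⟩
  obtain ⟨⟨x, _⟩, hp, rfl⟩ := mem_image.mp ht
  constructor <;> intro h
  · obtain ⟨t', ht', h'⟩ := H.mem_groupRows.mp (hg ▸ H.mem_helpers.mpr ⟨t, hp, h⟩)
    rwa [H.cycle_unique hp ht']
  · obtain ⟨t', ht', h'⟩ := H.mem_helpers.mp (hg.symm ▸ H.mem_groupRows.mpr ⟨t, hp, h⟩)
    rwa [H.cycle_unique hp ht']

/-- Two distinct columns of cycles of the same group are partners at the first level. -/
theorem mem_first_of_group_eq {t t' : ι} (h : H.group t = H.group t') {i j : V}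
    (hi : i ∈ H.cols t) (hj : j ∈ H.cols t') (hij : i ≠ j) : j ∈ H.first i := by
  obtain ⟨S, hS, hsub⟩ := H.group_clique (H.group t)
  have hadj := hS.prop (hsub t rfl hi) (hsub t' h.symm hj) hij
  rw [CooperationData.firstGraph, SimpleGraph.fromRel_adj] at hadj
  exact hadj.2.elim id (H.first_symm j i)

theorem γ_le_eta (P : CodeParams V ι) {t : ι} {i j : V} (h : (i, j) ∈ H.cycle t) :
    P.γ i t ≤ H.eta P j (H.level t j) :=
  (le_sup (f := fun i => P.γ i t) (H.mem_rowsAt.mpr h)).trans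
    (le_sup (f := fun t => (H.rowsAt t j).sup fun i => P.γ i t)
      (H.mem_cyclesAt.mpr ⟨H.mem_cols h, rfl⟩))

end Cycles

namespace CauchyPoints

variable {H : CompatibleGraph G ι} {P : CodeParams V ι} [Field F] (Q : H.CauchyPoints P F)
variable (m : (Σ i, Fin (P.k i)) → F)

/-! ### Cross parities -/

/-- The contribution `m_i B_{i,j}` of node `i` to the first-level cross parity of node `j`; it is
zero if the nodes are not partners. -/
def firstPart (i j : V) (z : Fin (P.δ j)) : F :=
  if h : j ∈ H.first i then ∑ x, m ⟨i, x⟩ * Q.firstBlock i j h x z else 0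

/-- The vector `m_i E_{i;t}`, extended by zeros to a sequence indexed by `ℕ`, so that zero padding
needs no further notation; it is zero if the cycle does not meet row `i`. -/
def cyclePart (i : V) (t : ι) (n : ℕ) : F :=
  if h : i ∈ H.rows t ∧ n < P.γ i t then ∑ x, m ⟨i, x⟩ * Q.cycleBlock i t h.1 x ⟨n, h.2⟩ else 0

/-- The first-level cross parity `s_j` received by node `j`. -/
def crossFirst [Fintype V] (j : V) (z : Fin (P.δ j)) : F := ∑ i, Q.firstPart m i j z

/-- The cross parity `w_{j;ℓ}` received by node `j` at level `ℓ`, extended by zeros. -/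
def crossCycle (j : V) (ℓ n : ℕ) : F :=
  ∑ t ∈ H.cyclesAt j ℓ, ∑ i ∈ H.rowsAt t j, Q.cyclePart m i t n

/-- The sum `W_{g;j}` of the contributions of the cycles of group `g` to node `j`. -/
def crossGroup (g : ℕ) (j : V) (n : ℕ) : F :=
  ∑ t : ι with H.group t = g, ∑ i ∈ H.rowsAt t j, Q.cyclePart m i t n

/-- The concatenation `(m_j, s_j, w_j)`, indexed by the rows of the Cauchy matrix `T_j`. -/
def localVec [Fintype V] (j : V) : H.RowIdx P j → F
  | Sum.inl x => m ⟨j, x⟩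
  | Sum.inr (Sum.inl z) => Q.crossFirst m j z
  | Sum.inr (Sum.inr z) => Q.crossCycle m j z.1.1 z.2

theorem firstPart_eq_zero {i : V} (hi : ∀ x, m ⟨i, x⟩ = 0) (j : V) (z : Fin (P.δ j)) :
    Q.firstPart m i j z = 0 := by
  simp [firstPart, hi]

theorem cyclePart_eq_zero {i : V} (hi : ∀ x, m ⟨i, x⟩ = 0) (t : ι) (n : ℕ) :
    Q.cyclePart m i t n = 0 := by
  simp [cyclePart, hi]

theorem vecMul_generator_inl [Fintype V] (j : V) (s : Fin (P.k j)) :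
    Matrix.vecMul m Q.generator ⟨j, Sum.inl s⟩ = m ⟨j, s⟩ := by
  simp [Matrix.vecMul, dotProduct, generator]

/-- The contribution of node `i` to the parity symbols of node `j`, sorted by its origin. At most
one of the three kinds of contribution is present. -/
theorem sum_mul_parityBlock (i j : V) (s : Fin (P.r j)) :
    ∑ x, m ⟨i, x⟩ * Q.parityBlock i j x s =
      (if i = j then ∑ x, m ⟨j, x⟩ * Q.cauchy j (Sum.inl x) (Sum.inl s) else 0) +
      ∑ z, Q.firstPart m i j z * Q.uBlock j z s +
      ∑ t, if ht : (i, j) ∈ H.cycle t then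
        ∑ z : Fin (H.eta P j (H.level t j)),
          Q.cyclePart m i t z * Q.vBlock j _ (H.level_mem_of_mem ht) z s else 0 := by
  by_cases hij : i = j
  · subst hij
    have h1 : i ∉ H.first i := fun h => G.irrefl (H.first_adj i i h)
    have h2 : ∀ t, (i, i) ∉ H.cycle t := fun t h => (H.cycle_off t i i h).1 rfl
    simp [parityBlock, firstPart, h1, h2, diagBlock]
  by_cases h : j ∈ H.first i
  · have h2 : ∀ t, (i, j) ∉ H.cycle t := fun t h' => (H.cycle_off t i j h').2 h
    simp only [parityBlock, hij, h, h2, firstPart, dif_pos, dif_neg, if_false, not_false_eq_true,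
      sum_const_zero, add_zero, zero_add, Matrix.mul_apply, mul_sum, sum_mul]
    rw [sum_comm]
    simp only [mul_assoc]
  · simp only [parityBlock, hij, h, firstPart, dif_neg, if_false, not_false_eq_true,
      zero_mul, sum_const_zero, zero_add, Matrix.sum_apply, mul_sum]
    rw [sum_comm]
    refine sum_congr rfl fun t _ => ?_
    by_cases ht : (i, j) ∈ H.cycle t
    · simp only [ht, dif_pos, Matrix.mul_apply, mul_sum]
      rw [sum_comm]
      refine sum_congr rfl fun z _ => ?_
      by_cases hz : (z : ℕ) < P.γ i t
      · simp [cyclePart, paddedBlock, hz, H.mem_rows ht, sum_mul, mul_assoc]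
      · simp [cyclePart, paddedBlock, hz]
    · simp [ht]

/-- The parity symbols of a node are the product of `(m_j, s_j, w_j)` with the first columns of
its Cauchy matrix. -/
theorem vecMul_generator_inr [Fintype V] (j : V) (s : Fin (P.r j)) :
    Matrix.vecMul m Q.generator ⟨j, Sum.inr s⟩ =
      ∑ x, Q.localVec m j x * Q.cauchy j x (Sum.inl s) := by
  have hlhs : Matrix.vecMul m Q.generator ⟨j, Sum.inr s⟩ =
      ∑ i, ∑ x, m ⟨i, x⟩ * Q.parityBlock i j x s := by
    simp [Matrix.vecMul, dotProduct, generator, Fintype.sum_sigma]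
  rw [hlhs, sum_congr rfl fun i _ => Q.sum_mul_parityBlock m i j s, sum_add_distrib,
    sum_add_distrib, Fintype.sum_sum_type, Fintype.sum_sum_type, ← add_assoc]
  congr 1
  · congr 1
    · simp [localVec]
    · rw [sum_comm]
      simp only [localVec, crossFirst, sum_mul]
      rfl
  · rw [Fintype.sum_sigma]
    simp only [localVec, crossCycle, sum_mul]
    -- Both sides become a sum over cycles `t`, and on the right over levels first; only the level
    -- of `t` in column `j` contributes.
    have hswap : ∀ ℓ : {ℓ : ℕ // ℓ ∈ Icc 2 (H.depth j)},
        ∑ z : Fin (H.eta P j ℓ.1), ∑ t ∈ H.cyclesAt j ℓ.1, ∑ i ∈ H.rowsAt t j,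
          Q.cyclePart m i t z * Q.cauchy j (Sum.inr (Sum.inr ⟨ℓ, z⟩)) (Sum.inl s) =
        ∑ t, ∑ i, if (i, j) ∈ H.cycle t ∧ H.level t j = ℓ.1 then
          ∑ z : Fin (H.eta P j ℓ.1), Q.cyclePart m i t z * Q.vBlock j ℓ.1 ℓ.2 z s else 0 := by
      intro ℓ
      rw [sum_comm, CooperationData.cyclesAt, sum_filter]
      refine sum_congr rfl fun t _ => ?_
      by_cases hℓ : H.level t j = ℓ.1
      · by_cases hj : j ∈ H.cols t
        · rw [if_pos ⟨hj, hℓ⟩, sum_comm, ← sum_filter]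
          refine sum_congr ?_ fun i _ => rfl
          ext i
          simp [mem_rowsAt, hℓ]
        · rw [if_neg fun h => hj h.1]
          exact (sum_eq_zero fun i _ => if_neg fun h => hj (H.mem_cols h.1)).symm
      · rw [if_neg fun h => hℓ h.2]
        exact (sum_eq_zero fun i _ => if_neg fun h => hℓ h.2).symm
    rw [sum_congr rfl fun ℓ _ => hswap ℓ, sum_comm, sum_comm (s := univ (α := {ℓ // _}))]
    refine sum_congr rfl fun t _ => ?_
    rw [sum_comm]
    refine sum_congr rfl fun i _ => ?_
    by_cases ht : (i, j) ∈ H.cycle t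
    · rw [dif_pos ht, sum_eq_single_of_mem (⟨H.level t j, H.level_mem_of_mem ht⟩ :
        {ℓ : ℕ // ℓ ∈ Icc 2 (H.depth j)}) (mem_univ _)]
      · rw [if_pos ⟨ht, rfl⟩]
      · exact fun ℓ _ hne => if_neg fun h => hne (Subtype.ext h.2.symm)
    · rw [dif_neg ht]
      exact (sum_eq_zero fun ℓ _ => if_neg fun h => ht h.1).symm

/-- Beyond the index `η_{j;ℓ}` the entries of the cross parity are padding. -/
theorem crossCycle_eq_zero_of_le {j : V} {ℓ n : ℕ} (hn : H.eta P j ℓ ≤ n) :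
    Q.crossCycle m j ℓ n = 0 := by
  refine sum_eq_zero fun t ht => sum_eq_zero fun i hi => dif_neg fun h => ?_
  obtain ⟨-, rfl⟩ := H.mem_cyclesAt.mp ht
  exact absurd h.2 (not_lt.mpr ((H.γ_le_eta P (H.mem_rowsAt.mp hi)).trans hn))

/-- If the levels and the groups in column `j` are matched, the cross parities of a level are those
of the group. -/
theorem crossCycle_eq_crossGroup {j : V} {ℓ g : ℕ}
    (h : ∀ t, j ∈ H.cols t → (H.level t j = ℓ ↔ H.group t = g)) (n : ℕ) :
    Q.crossCycle m j ℓ n = Q.crossGroup m g j n := by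
  rw [crossCycle, crossGroup]
  refine sum_subset ?_ ?_
  · intro t ht
    rw [mem_cyclesAt] at ht
    simpa using (h t ht.1).mp ht.2
  · intro t ht ht'
    refine sum_eq_zero fun i hi => absurd ?_ ht'
    have hj := H.mem_cols (H.mem_rowsAt.mp hi)
    exact H.mem_cyclesAt.mpr ⟨hj, (h t hj).mpr (by simpa using ht)⟩

/-- Every row of a cycle contains two of its positions, so each contribution occurs twice in the
sum over all columns. -/
theorem sum_crossGroup [Fintype V] [CharP F 2] (g n : ℕ) : ∑ j, Q.crossGroup m g j n = 0 := by
  simp only [crossGroup]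
  rw [sum_comm]
  refine sum_eq_zero fun t _ => ?_
  rw [sum_comm' (t' := H.rows t) (s' := fun i => H.colsAt t i)]
  · refine sum_eq_zero fun i hi => ?_
    rw [sum_const, H.colsAt_card t i hi, two_nsmul, CharTwo.add_self_eq_zero]
  · intro j i
    simp only [mem_univ, true_and, mem_rowsAt, mem_colsAt]
    exact ⟨fun h => ⟨h, H.mem_rows h⟩, fun h => h.1⟩

/-! ### Locally recoverable nodes -/

/-- At a locally recoverable node, the message and all cross parities vanish if all symbols that
are not erased do. -/
theorem localVec_eq_zero [Fintype V] {u : V → ℕ} {j : V} (hj : H.LocallyRecoverable P u j)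
    (E : Finset (Fin (P.k j) ⊕ Fin (P.r j))) (hE : E.card = u j)
    (hc : ∀ s ∉ E, Matrix.vecMul m Q.generator ⟨j, s⟩ = 0) : Q.localVec m j = 0 := by
  classical
  refine eq_zero_of_sum_cauchy_eq_zero (Q.a_injective j) (Q.b_injective j) (Q.a_ne_b j) _
    (E.toLeft.disjSum univ) (E.toRightᶜ.map ⟨Sum.inl, Sum.inl_injective⟩) ?_ ?_ ?_
  · rintro (x | x) hx
    · rw [inl_mem_disjSum, mem_toLeft] at hx
      exact (Q.vecMul_generator_inl m j x).symm.trans (hc _ hx)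
    · simp at hx
  · have h1 := E.card_toLeft_add_card_toRight
    have h2 : ∑ ℓ : {ℓ : ℕ // ℓ ∈ Icc 2 (H.depth j)}, H.eta P j ℓ.1 =
        ∑ ℓ ∈ Icc 2 (H.depth j), H.eta P j ℓ :=
      sum_coe_sort (Icc 2 (H.depth j)) fun ℓ => H.eta P j ℓ
    rw [LocallyRecoverable] at hj
    simp only [card_disjSum, card_map, card_compl, card_univ, Fintype.card_sum, Fintype.card_sigma,
      Fintype.card_fin, h2]
    omega
  · intro y hy
    obtain ⟨s, hs, rfl⟩ := mem_map.mp hy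
    rw [mem_compl, mem_toRight] at hs
    rw [← hc _ hs, vecMul_generator_inr]
    rfl

end CauchyPoints

/-! ### Non-local nodes -/

section Decoding

variable {H : CompatibleGraph G ι} {P : CodeParams V ι} [Field F] {Q : H.CauchyPoints P F}
variable {m : (Σ i, Fin (P.k i)) → F} {Loc : V → Prop}

/-- All cross parities vanish if `(m_j, s_j, w_j)` is zero at the locally recoverable nodes and the
partners of non-local nodes are locally recoverable. -/
theorem cross_eq_zero [Fintype V] [CharP F 2] (hloc : ∀ j, Loc j → Q.localVec m j = 0)
    (hfirst : ∀ i, ¬ Loc i → ∀ j ∈ H.first i, Loc j) (i : V) :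
    (∀ z, Q.crossFirst m i z = 0) ∧
      ∀ ℓ ∈ Icc 2 (H.depth i), ∀ n, Q.crossCycle m i ℓ n = 0 := by
  have hcyc : ∀ j, Loc j → ∀ ℓ ∈ Icc 2 (H.depth j), ∀ n, Q.crossCycle m j ℓ n = 0 := by
    intro j hj ℓ hℓ n
    rcases lt_or_ge n (H.eta P j ℓ) with hn | hn
    · exact congr_fun (hloc j hj) (Sum.inr (Sum.inr ⟨⟨ℓ, hℓ⟩, ⟨n, hn⟩⟩))
    · exact Q.crossCycle_eq_zero_of_le m hn
  by_cases hi : Loc i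
  · exact ⟨fun z => congr_fun (hloc i hi) (Sum.inr (Sum.inl z)), hcyc i hi⟩
  refine ⟨fun z => ?_, fun ℓ hℓ n => ?_⟩
  · rw [CauchyPoints.crossFirst]
    refine sum_eq_zero fun j _ => ?_
    by_cases hj : i ∈ H.first j
    · exact Q.firstPart_eq_zero m
        (fun x => congr_fun (hloc j (hfirst i hi j (H.first_symm j i hj))) (Sum.inl x)) i z
    · rw [CauchyPoints.firstPart, dif_neg hj]
  · obtain ⟨g, hg⟩ := H.exists_group_of_level i hℓ
    rw [Q.crossCycle_eq_crossGroup m hg]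
    by_cases hex : ∃ t, i ∈ H.cols t ∧ H.group t = g
    · obtain ⟨t, hit, rfl⟩ := hex
      rw [← Q.sum_crossGroup m (H.group t) n]
      symm
      refine sum_eq_single_of_mem i (mem_univ i) fun j _ hji => ?_
      by_cases hex' : ∃ t', j ∈ H.cols t' ∧ H.group t' = H.group t
      · obtain ⟨t', hjt', ht'⟩ := hex'
        have hj : Loc j :=
          hfirst i hi j (H.mem_first_of_group_eq ht'.symm hit hjt' hji.symm)
        have hℓ' := H.level_mem t' j hjt'
        obtain ⟨g', hg'⟩ := H.exists_group_of_level j hℓ'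
        have hgg : g' = H.group t := ((hg' t' hjt').mp rfl).symm.trans ht'
        rw [← hgg, ← Q.crossCycle_eq_crossGroup m hg']
        exact hcyc j hj _ hℓ' n
      · refine sum_eq_zero fun t' ht' => sum_eq_zero fun x hx => absurd ?_ hex'
        exact ⟨t', H.mem_cols (H.mem_rowsAt.mp hx), by simpa using ht'⟩
    · refine sum_eq_zero fun t ht => sum_eq_zero fun x hx => absurd ?_ hex
      exact ⟨t, H.mem_cols (H.mem_rowsAt.mp hx), by simpa using ht⟩

/-- If `i` is the only contributor to the first-level cross parity of `j` that is not known to be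
zero, its contribution vanishes. -/
theorem firstPart_eq_zero_of_forall_ne [Fintype V] {i j : V} (hcross : ∀ z, Q.crossFirst m j z = 0)
    (h : ∀ w ∈ H.first j, w ≠ i → ∀ x, m ⟨w, x⟩ = 0) (z : Fin (P.δ j)) :
    Q.firstPart m i j z = 0 := by
  rw [← hcross z, CauchyPoints.crossFirst]
  symm
  refine sum_eq_single_of_mem i (mem_univ i) fun w _ hwi => ?_
  by_cases hw : j ∈ H.first w
  · exact Q.firstPart_eq_zero m (h w (H.first_symm w j hw) hwi) j z
  · rw [CauchyPoints.firstPart, dif_neg hw]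

/-- If `i` is the only contributor to the cross parity of `j` at the level of the cycle `t` that is
not known to be zero, its contribution vanishes. -/
theorem cyclePart_eq_zero_of_forall_ne {i j : V} {t : ι} (ht : (i, j) ∈ H.cycle t)
    (hcross : ∀ n, Q.crossCycle m j (H.level t j) n = 0)
    (h : ∀ w ∈ H.helpers j (H.level t j), w ≠ i → ∀ x, m ⟨w, x⟩ = 0) (n : ℕ) :
    Q.cyclePart m i t n = 0 := by
  have hzero : ∀ t' ∈ H.cyclesAt j (H.level t j), ∀ w ∈ H.rowsAt t' j, w ≠ i →
      Q.cyclePart m w t' n = 0 := fun t' ht' w hw hwi =>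
    Q.cyclePart_eq_zero m (h w (mem_biUnion.mpr ⟨t', ht', hw⟩) hwi) t' n
  have ht0 : t ∈ H.cyclesAt j (H.level t j) := H.mem_cyclesAt.mpr ⟨H.mem_cols ht, rfl⟩
  rw [← hcross n, CauchyPoints.crossCycle, sum_eq_single_of_mem t ht0,
    sum_eq_single_of_mem i (H.mem_rowsAt.mpr ht)]
  · exact fun w hw hwi => hzero t ht0 w hw hwi
  · intro t' ht' hne
    refine sum_eq_zero fun w hw => hzero t' ht' w hw ?_
    -- The position `(i, j)` lies on no cycle but `t`.
    rintro rfl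
    exact hne (H.cycle_unique (H.mem_rowsAt.mp hw) ht)

/-- The message of a node vanishes if all cross parities that it receives, all its symbols that are
not erased, and sufficiently many of its contributions to other nodes do. -/
theorem message_eq_zero [Fintype V] {i : V} (hcross : ∀ z, Q.crossFirst m i z = 0)
    (hcross' : ∀ ℓ ∈ Icc 2 (H.depth i), ∀ n, Q.crossCycle m i ℓ n = 0)
    (E : Finset (Fin (P.k i) ⊕ Fin (P.r i)))
    (hc : ∀ s ∉ E, Matrix.vecMul m Q.generator ⟨i, s⟩ = 0)
    (A : Finset V) (hA : ∀ j ∈ A, ∀ z, Q.firstPart m i j z = 0)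
    (B : Finset ι) (hBrows : ∀ t ∈ B, i ∈ H.rows t) (hB : ∀ t ∈ B, ∀ n, Q.cyclePart m i t n = 0)
    (hcard : E.card ≤ P.r i + ∑ j ∈ H.first i ∩ A, P.δ j + ∑ t ∈ B, P.γ i t) (x : Fin (P.k i)) :
    m ⟨i, x⟩ = 0 := by
  classical
  suffices h : (fun x : Fin (P.k i) => m ⟨i, x⟩) = 0 from congr_fun h x
  refine eq_zero_of_sum_cauchy_eq_zero ((Q.a_injective i).comp Sum.inl_injective)
    (Q.b_injective i) (fun _ _ => Q.a_ne_b i _ _) _ E.toLeft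
    (E.toRightᶜ.disjSum (((univ.filter fun j => j.1 ∈ A).sigma fun _ => univ).disjSum
      ((univ.filter fun t => t.1 ∈ B).sigma fun _ => univ))) ?_ ?_ ?_
  · intro x hx
    rw [mem_toLeft] at hx
    exact (Q.vecMul_generator_inl m i x).symm.trans (hc _ hx)
  · have h1 := E.card_toLeft_add_card_toRight
    have h2 : ∑ j : {j : V // j ∈ H.first i} with j.1 ∈ A, P.δ j.1 =
        ∑ j ∈ H.first i ∩ A, P.δ j := by
      rw [sum_filter, sum_coe_sort (H.first i) fun j => if j ∈ A then P.δ j else 0, ← sum_filter,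
        filter_mem_eq_inter]
    have h3 : ∑ t : {t : ι // i ∈ H.rows t} with t.1 ∈ B, P.γ i t.1 = ∑ t ∈ B, P.γ i t := by
      rw [sum_filter, ← sum_subtype (univ.filter fun t => i ∈ H.rows t) (by simp)
        fun t => if t ∈ B then P.γ i t else 0, ← sum_filter]
      congr 1
      ext t
      simpa using hBrows t
    simp only [card_disjSum, card_compl, card_sigma, card_univ, Fintype.card_fin, h2, h3]
    omega
  · rintro (s | ⟨⟨j, hj⟩, z⟩ | ⟨⟨t, ht⟩, z⟩) hy
    · rw [inl_mem_disjSum, mem_compl, mem_toRight] at hy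
      rw [← hc _ hy, Q.vecMul_generator_inr, Fintype.sum_sum_type]
      have h0 : ∀ y, Q.localVec m i (Sum.inr y) = 0 := by
        rintro (z | z)
        · exact hcross z
        · exact hcross' z.1.1 z.1.2 _
      simp only [h0, zero_mul, sum_const_zero, add_zero]
      rfl
    · have hjA : j ∈ A := by simpa using hy
      have := hA j hjA z
      rw [CauchyPoints.firstPart, dif_pos hj] at this
      exact this
    · have htB : t ∈ B := by simpa using hy
      have := hB t htB z
      rw [CauchyPoints.cyclePart, dif_pos ⟨ht, z.2⟩] at this
      exact this

end Decoding

end CompatibleGraph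

/-! ### Decoding graphs -/

namespace IsDecodingGraph

variable {V ι : Type*} [DecidableEq V] [Fintype ι] {G : SimpleGraph V}
variable {H : CompatibleGraph G ι} {Loc : V → Prop} {root : V} {T : DirGraph V}

theorem mem_children {T : DirGraph V} {i j : V} : j ∈ T.children i ↔ (i, j) ∈ T.edges := by
  simp only [DirGraph.children, mem_filter, and_iff_right_iff_imp]
  exact fun h => (T.edges_mem i j h).2

theorem mem_parents {T : DirGraph V} {i j : V} : j ∈ T.parents i ↔ (j, i) ∈ T.edges := by
  simp only [DirGraph.parents, mem_filter, and_iff_right_iff_imp]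
  exact fun h => (T.edges_mem j i h).1

theorem loc_of_mem_children (hT : IsDecodingGraph H Loc root T) {i j : V} (hi : ¬ Loc i)
    (hij : (i, j) ∈ T.edges) : Loc j := by
  refine hT.not_loc_inner i (T.edges_mem i j hij).1 (fun h => ?_) hi j
    (mem_union_right _ (mem_children.mpr hij))
  have := mem_children.mpr hij
  rw [h.2] at this
  simp at this

/-- If `j` is a locally recoverable child of its first-level partner `i`, then the other non-local
partners of `j` are children of `j`. -/
theorem edge_of_mem_first (hT : IsDecodingGraph H Loc root T) {i j w : V} (hj : Loc j)
    (hij : (i, j) ∈ T.edges) (hi : i ∈ H.first j) (hw : w ∈ H.first j) (hwl : ¬ Loc w)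
    (hwi : w ≠ i) : (j, w) ∈ T.edges := by
  obtain ⟨Λ, -, hcard, -, hiff⟩ := hT.loc_inner j (T.edges_mem i j hij).2
    (fun h => hT.leaf_not_loc j h hj) hj
  have hip : i ∈ T.parents j ∩ H.first j := mem_inter.mpr ⟨mem_parents.mpr hij, hi⟩
  have hone : (T.parents j ∩ H.first j).card = 1 := le_antisymm hcard (card_pos.mpr ⟨i, hip⟩)
  rcases mem_union.mp ((hiff w).mpr ⟨hwl, Or.inr ⟨hone, hw⟩⟩) with h | h
  · exact absurd (card_le_one.mp hcard w (mem_inter.mpr ⟨h, hw⟩) i hip) hwi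
  · exact mem_children.mp h

/-- If `j` is a locally recoverable child of `i` and `(i, j)` is a position of the cycle `t`, then
the other non-local nodes that cooperate with `j` at the level of `t` are children of `j`. -/
theorem edge_of_mem_helpers (hT : IsDecodingGraph H Loc root T) {i j w : V} {t : ι} (hj : Loc j)
    (hij : (i, j) ∈ T.edges) (ht : (i, j) ∈ H.cycle t)
    (hw : w ∈ H.helpers j (H.level t j)) (hwl : ¬ Loc w) (hwi : w ≠ i) : (j, w) ∈ T.edges := by
  obtain ⟨Λ, -, -, hcard, hiff⟩ := hT.loc_inner j (T.edges_mem i j hij).2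
    (fun h => hT.leaf_not_loc j h hj) hj
  have hip : i ∈ T.parents j := mem_parents.mpr hij
  -- The parent `i` helps `j` only at the level of `t`, so this level belongs to `Λ`.
  have hΛ : H.level t j ∈ Λ := by
    rcases ((hiff i).mp (mem_union_left _ hip)).2 with ⟨ℓ, hℓ, hi⟩ | ⟨-, hi⟩
    · obtain ⟨t', ht', rfl⟩ := H.mem_helpers.mp hi
      rwa [H.cycle_unique ht ht']
    · exact absurd (H.first_symm j i hi) (H.cycle_off t i j ht).2
  have hih : i ∈ H.helpers j (H.level t j) := H.mem_helpers.mpr ⟨t, ht, rfl⟩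
  rcases mem_union.mp ((hiff w).mpr ⟨hwl, Or.inl ⟨_, hΛ, hw⟩⟩) with h | h
  · exact absurd (card_le_one.mp (hcard _ hΛ).le w (mem_inter.mpr ⟨h, hw⟩) i
      (mem_inter.mpr ⟨hip, hih⟩)) hwi
  · exact mem_children.mp h

/-- Induction on a decoding graph from the leaves to the root. -/
theorem induction_on [Finite V] (hT : IsDecodingGraph H Loc root T) {p : V → Prop}
    (step : ∀ i ∈ T.verts, ¬ Loc i →
      (∀ j w, (i, j) ∈ T.edges → (j, w) ∈ T.edges → ¬ Loc w → p w) → p i)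
    {i : V} (hi : i ∈ T.verts) (hl : ¬ Loc i) : p i := by
  let R : V → V → Prop := fun w v => Relation.TransGen (fun v w => (v, w) ∈ T.edges) v w
  have : IsTrans V R := ⟨fun _ _ _ h h' => h'.trans h⟩
  have : Std.Irrefl R := ⟨hT.acyclic⟩
  induction i using (Finite.wellFounded_of_trans_of_irrefl R).induction with
  | _ i ih =>
    refine step i hi hl fun j w hij hjw hw => ?_
    exact ih w (Relation.TransGen.head hij (Relation.TransGen.single hjw))
      (T.edges_mem j w hjw).2 hw

end IsDecodingGraph

open CompatibleGraph IsDecodingGraph in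
/-- The message of a codeword that vanishes at all positions that are not erased is zero. -/
theorem message_eq_zero_of_vecMul_eq_zero {V ι F : Type*} [Fintype V] [DecidableEq V] [Fintype ι]
    [Field F] [CharP F 2] {G : SimpleGraph V} {H : CompatibleGraph G ι} {P : CodeParams V ι}
    {Q : H.CauchyPoints P F} {u : V → ℕ}
    (hfirst : ∀ i, ¬ H.LocallyRecoverable P u i →
      ∀ j ∈ H.first i, H.LocallyRecoverable P u j)
    (hgraph : ∀ i, ¬ H.LocallyRecoverable P u i → ∃ T : DirGraph V,
      IsDecodingGraph H (H.LocallyRecoverable P u) i T ∧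
      ∀ j ∈ T.verts, ¬ H.LocallyRecoverable P u j →
        u j ≤ P.r j + ∑ m ∈ H.first j ∩ T.children j, P.δ m +
          ∑ t : ι with (H.colsAt t j ∩ T.children j).Nonempty, P.γ j t)
    {erased : ∀ i, Finset (Fin (P.k i) ⊕ Fin (P.r i))} (hcard : ∀ i, (erased i).card = u i)
    {m : (Σ i, Fin (P.k i)) → F}
    (hc : ∀ i, ∀ s ∉ erased i, Matrix.vecMul m Q.generator ⟨i, s⟩ = 0) : m = 0 := by
  have hloc : ∀ j, H.LocallyRecoverable P u j → Q.localVec m j = 0 := fun j hj =>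
    Q.localVec_eq_zero m hj (erased j) (hcard j) (hc j)
  have hcross := cross_eq_zero hloc hfirst
  suffices h : ∀ i x, m ⟨i, x⟩ = 0 from funext fun ⟨i, x⟩ => h i x
  have hlocm : ∀ j, H.LocallyRecoverable P u j → ∀ x, m ⟨j, x⟩ = 0 := fun j hj x =>
    congr_fun (hloc j hj) (Sum.inl x)
  intro i
  by_cases hi : H.LocallyRecoverable P u i
  · exact hlocm i hi
  obtain ⟨T, hT, hbound⟩ := hgraph i hi
  refine hT.induction_on (p := fun i => ∀ x, m ⟨i, x⟩ = 0) ?_ hT.root_mem hi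
  intro i hiT hi ih
  refine message_eq_zero (hcross i).1 (hcross i).2 (erased i) (hc i)
    (H.first i ∩ T.children i) ?_
    (univ.filter fun t => (H.colsAt t i ∩ T.children i).Nonempty) ?_ ?_ ?_
  · intro j hj
    obtain ⟨hj, hij⟩ := mem_inter.mp hj
    rw [mem_children] at hij
    have hjl := hT.loc_of_mem_children hi hij
    refine firstPart_eq_zero_of_forall_ne (hcross j).1 fun w hw hwi => ?_
    by_cases hwl : H.LocallyRecoverable P u w
    · exact hlocm w hwl
    · exact ih j w hij
        (hT.edge_of_mem_first hjl hij (H.first_symm i j hj) hw hwl hwi) hwl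
  · intro t ht
    obtain ⟨j, hj⟩ := (mem_filter.mp ht).2
    exact H.mem_rows (H.mem_colsAt.mp (mem_inter.mp hj).1)
  · intro t ht
    obtain ⟨j, hj⟩ := (mem_filter.mp ht).2
    obtain ⟨hj, hij⟩ := mem_inter.mp hj
    rw [mem_children] at hij
    rw [mem_colsAt] at hj
    have hjl := hT.loc_of_mem_children hi hij
    refine cyclePart_eq_zero_of_forall_ne hj ((hcross j).2 _ (H.level_mem_of_mem hj))
      fun w hw hwi => ?_
    by_cases hwl : H.LocallyRecoverable P u w
    · exact hlocm w hwl
    · exact ih j w hij (hT.edge_of_mem_helpers hjl hij hj hw hwl hwi) hwl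
  · rw [hcard i, ← inter_assoc, inter_self]
    exact hbound i hiT hi

theorem mainTheorem2 {V ι F : Type*} [Fintype V] [DecidableEq V] [Fintype ι]
    [Field F] [Finite F] [CharP F 2]
    (G : SimpleGraph V) (H : CompatibleGraph G ι) (P : CodeParams V ι)
    (Q : H.CauchyPoints P F)
    (u : V → ℕ) (hu : ∀ i, u i ≤ P.k i + P.r i)
    (hfirst : ∀ i, ¬ H.LocallyRecoverable P u i →
      ∀ j ∈ H.first i, H.LocallyRecoverable P u j)
    (hgraph : ∀ i, ¬ H.LocallyRecoverable P u i → ∃ T : DirGraph V,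
      IsDecodingGraph H (H.LocallyRecoverable P u) i T ∧
      (∀ j, T.IsLeaf j → u j ≤ P.r j) ∧
      ∀ j ∈ T.verts, ¬ H.LocallyRecoverable P u j →
        u j ≤ P.r j + ∑ m ∈ H.first j ∩ T.children j, P.δ m +
          ∑ t : ι with (H.colsAt t j ∩ T.children j).Nonempty, P.γ j t) :
    IsRecoverablePattern Q.code u := by
  rintro erased hcard c ⟨m, rfl⟩ c' ⟨m', rfl⟩ hcc
  simp only [Matrix.vecMulLinear_apply] at hcc ⊢
  have hgraph' := fun i hi => (hgraph i hi).imp fun T hT => And.intro hT.1 hT.2.2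
  rw [sub_eq_zero.mp (message_eq_zero_of_vecMul_eq_zero (m := m - m') hfirst hgraph' hcard
    fun i s hs => by rw [Matrix.sub_vecMul, Pi.sub_apply, hcc i s hs, sub_self])]
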